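/- Let $\kappa$ be an infinite regular cardinal. A category is $\kappa$-lex if it has all $\kappa$-small limits (limits of diagrams indexed by categories with fewer than $\kappa$ morphisms), and a functor is $\kappa$-lex if it preserves them. A category $\mathcal{C}$ is $\kappa$-regular if it is $\kappa$-lex and regular, and effective epimorphisms are closed under transfinite cocomposition of length $<\kappa$: whenever $J$ is a non-empty well-ordered set of cardinality $<\kappa$ and $X\colon J^{op}\to\mathcal{C}$ is such that $X_{j+1}\to X_j$ is an effective epimorphism for every non-maximal $j\in J$ and $X_j=\lim_{i<j}X_i$ for every limit element $j\in J$, the projection $\lim_{j\in J} X_j\to X_0$ to the value at the least element is an effective epimorphism. A functor is $\kappa$-regular if it is $\kappa$-lex and preserves effective epimorphisms. For a small category $\mathcal{C}$ let $\mathbf{Lex}_\kappa(\mathcal{C},\mathbf{Set})$ be the category of $\kappa$-lex functors $\mathcal{C}\to\mathbf{Set}$ and all natural transformations between them. A natural transformation between such functors is elementary if its naturality squares at monomorphisms of $\mathcal{C}$ are pullbacks. **Theorem.** Let $\mathcal{C}$ be a small $\kappa$-regular category. Then for every $\kappa$-lex functor $F\colon\mathcal{C}\to\mathbf{Set}$ there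 exist a $\kappa$-regular functor $G\colon\mathcal{C}\to\mathbf{Set}$ and a natural transformation $\alpha\colon F\Rightarrow G$ which is a regular monomorphism in $\mathbf{Lex}_\kappa(\mathcal{C},\mathbf{Set})$ and is also elementary. -/

import Mathlib

open CategoryTheory CategoryTheory.Limits Opposite

universe u v₁ u₁ v₂ u₂

namespace KappaRegular

/-- A category is `κ`-lex if it has all `κ`-small limits, i.e. limits of all diagrams whose
indexing category has fewer than `κ` morphisms. -/
def IsKappaLexCategory (κ : Cardinal.{u}) (C : Type u₁) [Category.{v₁} C] : Prop :=
  ∀ (J : Type u) [SmallCategory J], HasCardinalLT (Arrow J) κ → HasLimitsOfShape J C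

/-- A functor is `κ`-lex if it preserves all `κ`-small limits. -/
def IsKappaLexFunctor (κ : Cardinal.{u}) {C : Type u₁} [Category.{v₁} C]
    {D : Type u₂} [Category.{v₂} D] (F : C ⥤ D) : Prop :=
  ∀ (J : Type u) [SmallCategory J], HasCardinalLT (Arrow J) κ → PreservesLimitsOfShape J F

/-- The class of effective epimorphisms of a category. -/
def effectiveEpis (C : Type u₁) [Category.{v₁} C] : MorphismProperty C :=
  fun _ _ f => EffectiveEpi f

/-- A `κ`-regular category: it has `κ`-small limits, it is regular, and effective epimorphisms are
closed under transfinite cocomposition of length less than `κ`. The latter means: given a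
well-ordered set `J` of cardinality less than `κ` and a cochain `X : Jᵒᵖ ⥤ C` with
`X (j + 1) ⟶ X j` an effective epimorphism for all non-maximal `j`, and with
`X j = lim_{i < j} X i` at limit elements `j`, the projection `lim X ⟶ X ⊥` is an effective
epimorphism. (These are the transfinite compositions in `Cᵒᵖ` of opposites of effective
epimorphisms of `C`.) -/
structure IsKappaRegularCategory (κ : Cardinal.{u}) (C : Type u₁) [Category.{v₁} C] : Prop where
  lex : IsKappaLexCategory κ C
  regular : Regular C
  cocomposition : ∀ (J : Type u) [LinearOrder J] [SuccOrder J] [OrderBot J] [WellFoundedLT J],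
    HasCardinalLT J κ → (effectiveEpis C).op.IsStableUnderTransfiniteCompositionOfShape J

/-- A `κ`-regular functor: it preserves `κ`-small limits and effective epimorphisms. -/
structure IsKappaRegularFunctor (κ : Cardinal.{u}) {C : Type u₁} [Category.{v₁} C]
    {D : Type u₂} [Category.{v₂} D] (F : C ⥤ D) : Prop where
  lex : IsKappaLexFunctor κ F
  preservesEffectiveEpis : F.PreservesEffectiveEpis

/-- The category `Lex_κ(C, Set)` of `κ`-lex functors from a small category to sets, as a full
subcategory of the category of all functors. -/
abbrev LexCat (κ : Cardinal.{u}) (C : Type u) [SmallCategory C] :=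
  ObjectProperty.FullSubcategory (fun F : C ⥤ Type u => IsKappaLexFunctor κ F)

/-- A natural transformation is elementary if its naturality squares at monomorphisms are
pullbacks. -/
def IsElementary {C : Type u₁} [Category.{v₁} C] {D : Type u₂} [Category.{v₂} D]
    {F G : C ⥤ D} (α : F ⟶ G) : Prop :=
  ∀ ⦃a x : C⦄ (i : a ⟶ x) [Mono i], IsPullback (F.map i) (α.app a) (α.app x) (G.map i)

end KappaRegular

namespace KappaRegular

/-! Write `F` as a `κ`-directed colimit of representables `C(Y_S, -)` and look for `G` as a colimit
of representables `C(X_S, -)` over the same index set, with `α` induced by effective epimorphisms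
`X_S ⟶ Y_S`. `exists_extension_of_indPresentation` shows that this suffices. Since each `Y_S` is the
quotient of `X_S` by its kernel pair, `F` is the equalizer of the two maps from `G` to the colimit
of representables given by the kernel pairs. Since effective epimorphisms are orthogonal to
monomorphisms, `α` is elementary. `G` is `κ`-lex by `κ`-directedness, and it preserves effective
epimorphisms as soon as every `X_S ⟶ b` lifts along every effective epimorphism `a ⟶ b` after
passing to a later stage.

Such a diagram is built in one go. A name is an object of `C` with fewer than `κ` morphisms to
earlier names; basic names carry an element of `F` and record its category of elements, while cover
names adjoin formal lifts along effective epimorphisms. `S` runs over closed sets of fewer than `κ`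
such names, `X_S` is the limit over `S`, and `Y_S` the limit over the basic names of `S`. Forgetting
the covers is a transfinite cocomposition of pullbacks of effective epimorphisms
(`Down.effectiveEpi_restrict`), which is where `κ`-regularity enters. -/

/-- Every family of fewer than `κ` elements of `P` has an upper bound. -/
def IsCardinalDirected (κ : Cardinal.{u}) (P : Type u) [Preorder P] : Prop :=
  ∀ ⦃ι : Type u⦄ (s : ι → P), HasCardinalLT ι κ → ∃ j, ∀ k, s k ≤ j

/-! ### Directed colimits of representable functors -/

section IndRep

variable {C : Type u} [SmallCategory C] {P : Type u} [Preorder P]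

/-- Two morphisms out of values of a cofiltered diagram which agree at a later stage. -/
def IndRel (X : Pᵒᵖ ⥤ C) (a : C) (s t : Σ p : P, X.obj (op p) ⟶ a) : Prop :=
  ∃ (r : P) (hs : s.1 ≤ r) (ht : t.1 ≤ r),
    X.map (homOfLE hs).op ≫ s.2 = X.map (homOfLE ht).op ≫ t.2

lemma IndRel.comp {X : Pᵒᵖ ⥤ C} {a b : C} (f : a ⟶ b) {s t : Σ p : P, X.obj (op p) ⟶ a}
    (h : IndRel X a s t) : IndRel X b ⟨s.1, s.2 ≫ f⟩ ⟨t.1, t.2 ≫ f⟩ := by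
  obtain ⟨r, hs, ht, h⟩ := h
  exact ⟨r, hs, ht, by simp [reassoc_of% h]⟩

lemma map_homOfLE_trans (X : Pᵒᵖ ⥤ C) {p q r : P} (h₁ : p ≤ q) (h₂ : q ≤ r) :
    X.map (homOfLE h₂).op ≫ X.map (homOfLE h₁).op = X.map (homOfLE (h₁.trans h₂)).op := by
  rw [← X.map_comp]; rfl

variable [IsDirectedOrder P]

/-- Equality at a later stage, as an equivalence relation. -/
def indSetoid (X : Pᵒᵖ ⥤ C) (a : C) : Setoid (Σ p : P, X.obj (op p) ⟶ a) where
  r := IndRel X a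
  iseqv :=
    { refl s := ⟨s.1, le_rfl, le_rfl, rfl⟩
      symm := fun ⟨r, hs, ht, h⟩ => ⟨r, ht, hs, h.symm⟩
      trans := by
        rintro s t v ⟨r, hs, ht, h⟩ ⟨r', ht', hv, h'⟩
        obtain ⟨q, hq, hq'⟩ := exists_ge_ge r r'
        refine ⟨q, hs.trans hq, hv.trans hq', ?_⟩
        rw [← map_homOfLE_trans X hs hq, ← map_homOfLE_trans X hv hq', Category.assoc,
          Category.assoc, h, ← h', ← Category.assoc, ← Category.assoc, map_homOfLE_trans,
          map_homOfLE_trans] }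

/-- The filtered colimit of the functors represented by the values of a cofiltered diagram. -/
def indRep (X : Pᵒᵖ ⥤ C) : C ⥤ Type u where
  obj a := Quotient (indSetoid X a)
  map {a b} f := ↾(Quotient.map (fun s => ⟨s.1, s.2 ≫ f⟩) (fun _ _ h => IndRel.comp f h))
  map_id a := by
    ext x
    induction x using Quotient.inductionOn
    simp
  map_comp f g := by
    ext x
    induction x using Quotient.inductionOn with
    | h s =>
      refine congrArg (Quotient.mk (indSetoid X _)) ?_
      exact congrArg (Sigma.mk s.1) (Category.assoc _ _ _).symm

namespace indRep

/-- The element of `indRep X` given by a morphism out of a value of `X`. -/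
def mk (X : Pᵒᵖ ⥤ C) {a : C} (p : P) (e : X.obj (op p) ⟶ a) : (indRep X).obj a :=
  Quotient.mk (indSetoid X a) ⟨p, e⟩

variable {X : Pᵒᵖ ⥤ C}

lemma exists_eq_mk {a : C} (x : (indRep X).obj a) :
    ∃ (p : P) (e : X.obj (op p) ⟶ a), x = mk X p e := by
  induction x using Quotient.inductionOn with
  | h s => exact ⟨s.1, s.2, rfl⟩

lemma map_mk {a b : C} (f : a ⟶ b) (p : P) (e : X.obj (op p) ⟶ a) :
    (indRep X).map f (mk X p e) = mk X p (e ≫ f) := rfl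

lemma mk_eq_mk_iff {a : C} {p q : P} {e : X.obj (op p) ⟶ a} {e' : X.obj (op q) ⟶ a} :
    mk X p e = mk X q e' ↔ ∃ (r : P) (hp : p ≤ r) (hq : q ≤ r),
      X.map (homOfLE hp).op ≫ e = X.map (homOfLE hq).op ≫ e' :=
  ⟨fun h => Quotient.exact h, fun h => Quotient.sound h⟩

lemma mk_eq_mk_iff' {a : C} {p : P} {e e' : X.obj (op p) ⟶ a} :
    mk X p e = mk X p e' ↔ ∃ (r : P) (hp : p ≤ r),
      X.map (homOfLE hp).op ≫ e = X.map (homOfLE hp).op ≫ e' := by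
  rw [mk_eq_mk_iff]
  exact ⟨fun ⟨r, h, _, e⟩ => ⟨r, h, e⟩, fun ⟨r, h, e⟩ => ⟨r, h, h, e⟩⟩

lemma mk_map {a : C} {p q : P} (h : p ≤ q) (e : X.obj (op p) ⟶ a) :
    mk X q (X.map (homOfLE h).op ≫ e) = mk X p e :=
  mk_eq_mk_iff.2 ⟨q, le_rfl, h, by simp⟩

lemma exists_le_eq_mk {a : C} {p q : P} (h : p ≤ q) {x : (indRep X).obj a}
    (hx : ∃ e : X.obj (op p) ⟶ a, x = mk X p e) : ∃ e : X.obj (op q) ⟶ a, x = mk X q e := by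
  obtain ⟨e, rfl⟩ := hx
  exact ⟨_, (mk_map h e).symm⟩

/-- The natural transformation of filtered colimits of representables induced by a natural
transformation of diagrams. -/
def mapHom {X Y : Pᵒᵖ ⥤ C} (π : X ⟶ Y) : indRep Y ⟶ indRep X where
  app a := ↾(Quotient.map (fun s => ⟨s.1, π.app _ ≫ s.2⟩) (by
    rintro s t ⟨r, hs, ht, h⟩
    exact ⟨r, hs, ht, by rw [π.naturality_assoc, π.naturality_assoc, h]⟩))
  naturality a b f := by
    ext x
    obtain ⟨p, e, rfl⟩ := exists_eq_mk x
    exact congrArg (mk X p) (Category.assoc _ _ _).symm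

lemma mapHom_mk {X Y : Pᵒᵖ ⥤ C} (π : X ⟶ Y) {a : C} (p : P) (e : Y.obj (op p) ⟶ a) :
    (mapHom π).app a (mk Y p e) = mk X p (π.app _ ≫ e) := rfl

/-- Representables preserve limits, and `κ`-directed colimits of sets commute with `κ`-small limits:
the stages witnessing fewer than `κ` equalities have a common upper bound. -/
lemma isKappaLexFunctor {κ : Cardinal.{u}} [Fact κ.IsRegular] (hP : IsCardinalDirected κ P)
    (X : Pᵒᵖ ⥤ C) : IsKappaLexFunctor κ (indRep X) := by
  intro J _ hJ
  refine ⟨fun {K} => ⟨fun {c} hc => ?_⟩⟩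
  have hJ₀ : HasCardinalLT J κ := hasCardinalLT_of_hasCardinalLT_arrow hJ
  refine (Types.isLimit_iff _).2 fun s hs => ?_
  have hinj : ∀ x y : (indRep X).obj c.pt,
      (∀ j, (indRep X).map (c.π.app j) x = (indRep X).map (c.π.app j) y) → x = y := by
    intro x y h
    obtain ⟨p, e, rfl⟩ := exists_eq_mk x
    obtain ⟨q, e', rfl⟩ := exists_eq_mk y
    choose r hp hq h using fun j => mk_eq_mk_iff.1 (h j)
    obtain ⟨m, hm⟩ := hP r hJ₀
    obtain ⟨m', hm', hpm⟩ := exists_ge_ge m p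
    obtain ⟨n, hn, hqn⟩ := exists_ge_ge m' q
    refine mk_eq_mk_iff.2 ⟨n, hpm.trans hn, hqn, hc.hom_ext fun j => ?_⟩
    rw [← map_homOfLE_trans X (hp j) ((hm j).trans (hm'.trans hn)),
      ← map_homOfLE_trans X (hq j) ((hm j).trans (hm'.trans hn)), Category.assoc,
      Category.assoc, Category.assoc, Category.assoc, h j]
  have hex : ∃ x : (indRep X).obj c.pt, ∀ j, (indRep X).map (c.π.app j) x = s j := by
    choose p e he using fun j => exists_eq_mk (s j)
    obtain ⟨m, hm⟩ := hP p hJ₀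
    choose e' he' using fun j => exists_le_eq_mk (hm j) ⟨e j, he j⟩
    have h (φ : Arrow J) : ∃ (r : P) (hr : m ≤ r), X.map (homOfLE hr).op ≫ e' φ.left ≫ K.map φ.hom
        = X.map (homOfLE hr).op ≫ e' φ.right := by
      refine mk_eq_mk_iff'.1 ?_
      rw [← map_mk, ← he', ← he']
      exact hs φ.hom
    choose r hr h using h
    -- The extra point stands for the stage `m`, so that the bound lies above `m` even when `J` is
    -- empty.
    have : HasCardinalLT (Option (Arrow J)) κ :=
      (hasCardinalLT_option_iff _ _ (Cardinal.IsRegular.aleph0_le Fact.out)).2 hJ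
    obtain ⟨n, hn⟩ := hP (fun o : Option (Arrow J) => o.elim m r) this
    have hmn : m ≤ n := hn none
    have hrn : ∀ φ, r φ ≤ n := fun φ => hn (some φ)
    refine ⟨mk X n (hc.lift ⟨_, { app := fun j => X.map (homOfLE hmn).op ≫ e' j
                                  naturality := fun j k φ => ?_ }⟩), fun j => ?_⟩
    · have := h (Arrow.mk φ)
      dsimp at this ⊢
      rw [Category.id_comp, Category.assoc, ← map_homOfLE_trans X (hr (Arrow.mk φ)) (hrn _),
        Category.assoc, Category.assoc, this]
    · rw [map_mk, hc.fac, he', mk_map]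
  obtain ⟨x, hx⟩ := hex
  exact ⟨x, hx, fun y hy => hinj _ _ fun j => (hy j).trans (hx j).symm⟩

end indRep

end IndRep

/-! ### Extending a presented functor along levelwise effective epimorphisms -/

section Extension

variable {C : Type u} [SmallCategory C] {P : Type u} [Preorder P]

/-- A compatible family of elements exhibiting a functor as the filtered colimit of the functors
represented by the values of a cofiltered diagram. -/
structure IndPresentation (F : C ⥤ Type u) (Y : Pᵒᵖ ⥤ C) where
  /-- the universal elements -/
  elt (p : P) : F.obj (Y.obj (op p))
  map_elt {p q : P} (h : p ≤ q) : F.map (Y.map (homOfLE h).op) (elt q) = elt p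
  exists_eq {a : C} (x : F.obj a) : ∃ (p : P) (e : Y.obj (op p) ⟶ a), F.map e (elt p) = x
  exists_map_eq {a : C} {p : P} {e e' : Y.obj (op p) ⟶ a} (h : F.map e (elt p) = F.map e' (elt p)) :
    ∃ (q : P) (hq : p ≤ q), Y.map (homOfLE hq).op ≫ e = Y.map (homOfLE hq).op ≫ e'

variable [IsDirectedOrder P] {F : C ⥤ Type u} {Y : Pᵒᵖ ⥤ C}

namespace IndPresentation

variable (w : IndPresentation F Y)

lemma map_eq_iff {a : C} {p q : P} {e : Y.obj (op p) ⟶ a} {e' : Y.obj (op q) ⟶ a} :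
    F.map e (w.elt p) = F.map e' (w.elt q) ↔ indRep.mk Y p e = indRep.mk Y q e' := by
  constructor
  · intro h
    obtain ⟨r, hp, hq⟩ := exists_ge_ge p q
    rw [← indRep.mk_map hp, ← indRep.mk_map hq]
    refine indRep.mk_eq_mk_iff'.2 (w.exists_map_eq ?_)
    rw [F.map_comp, F.map_comp, comp_apply, comp_apply, w.map_elt, w.map_elt, h]
  · intro h
    obtain ⟨r, hp, hq, h⟩ := indRep.mk_eq_mk_iff.1 h
    rw [← w.map_elt hp, ← w.map_elt hq, ← comp_apply, ← comp_apply, ← F.map_comp,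
      ← F.map_comp, h]

/-- A presented functor maps to the filtered colimit of representables given by its
presentation. -/
noncomputable def toIndRep : F ⟶ indRep Y where
  app a := ↾fun x => indRep.mk Y _ (w.exists_eq x).choose_spec.choose
  naturality a b f := by
    ext x
    refine (w.map_eq_iff).1 ?_
    rw [(w.exists_eq (F.map f x)).choose_spec.choose_spec, F.map_comp, comp_apply,
      (w.exists_eq x).choose_spec.choose_spec]

lemma toIndRep_map {a : C} (p : P) (e : Y.obj (op p) ⟶ a) :
    w.toIndRep.app a (F.map e (w.elt p)) = indRep.mk Y p e :=
  (w.map_eq_iff).1 (w.exists_eq (F.map e (w.elt p))).choose_spec.choose_spec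

end IndPresentation

end Extension

/-- The reduction of the theorem to a construction in `C`: `hX` makes `G` preserve effective
epimorphisms, and `hπ` alone makes `α` a regular monomorphism and elementary. -/
theorem exists_extension_of_indPresentation {κ : Cardinal.{u}} [Fact κ.IsRegular] {C : Type u}
    [SmallCategory C] [HasPullbacks C] (F : LexCat κ C) {P : Type u} [Preorder P]
    [IsDirectedOrder P] (hP : IsCardinalDirected κ P) {X Y : Pᵒᵖ ⥤ C} (π : X ⟶ Y)
    (hπ : ∀ p, EffectiveEpi (π.app p)) (w : IndPresentation F.obj Y)
    (hX : ∀ ⦃p : P⦄ ⦃a b : C⦄ (f : a ⟶ b) [EffectiveEpi f] (e : X.obj (op p) ⟶ b),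
      ∃ (q : P) (hq : p ≤ q) (d : X.obj (op q) ⟶ a), d ≫ f = X.map (homOfLE hq).op ≫ e) :
    ∃ (G : LexCat κ C) (α : F ⟶ G),
      IsKappaRegularFunctor κ G.obj ∧ IsRegularMono α ∧ IsElementary α.hom := by
  have hG : IsKappaLexFunctor κ (indRep X) := indRep.isKappaLexFunctor hP X
  let α : F.obj ⟶ indRep X := w.toIndRep ≫ indRep.mapHom π
  have hα {a : C} (p : P) (e : Y.obj (op p) ⟶ a) :
      α.app a (F.obj.map e (w.elt p)) = indRep.mk X p (π.app _ ≫ e) := by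
    dsimp [α]
    rw [w.toIndRep_map, indRep.mapHom_mk]
  have hinj (a : C) : Function.Injective (α.app a) := by
    intro x y h
    obtain ⟨p, e, rfl⟩ := w.exists_eq x
    obtain ⟨q, e', rfl⟩ := w.exists_eq y
    rw [hα, hα, indRep.mk_eq_mk_iff] at h
    obtain ⟨r, hp, hq, h⟩ := h
    rw [w.map_eq_iff, indRep.mk_eq_mk_iff]
    refine ⟨r, hp, hq, ?_⟩
    have := hπ (op r)
    rw [← cancel_epi (π.app (op r)), ← π.naturality_assoc, ← π.naturality_assoc, h]
  -- The levelwise kernel pair of `π`; `α` will be the equalizer of the two maps `indRep X ⟶ indRep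
  -- H`.
  let H : Pᵒᵖ ⥤ C := pullback π π
  let l : H ⟶ X := pullback.fst π π
  let r : H ⟶ X := pullback.snd π π
  have hlr : l ≫ π = r ≫ π := pullback.condition
  have hpb (p : P) : IsPullback (l.app (op p)) (r.app (op p)) (π.app (op p)) (π.app (op p)) :=
    (IsPullback.of_hasPullback π π).map ((evaluation _ _).obj (op p))
  have hαlr (a : C) (x : F.obj.obj a) :
      (indRep.mapHom l).app a (α.app a x) = (indRep.mapHom r).app a (α.app a x) := by
    obtain ⟨p, e, rfl⟩ := w.exists_eq x
    rw [hα, indRep.mapHom_mk, indRep.mapHom_mk, ← Category.assoc, ← Category.assoc,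
      ← NatTrans.comp_app, ← NatTrans.comp_app, hlr]
  have hrange (a : C) (y : (indRep X).obj a)
      (hy : (indRep.mapHom l).app a y = (indRep.mapHom r).app a y) : ∃ x, α.app a x = y := by
    obtain ⟨p, e, rfl⟩ := indRep.exists_eq_mk y
    rw [indRep.mapHom_mk, indRep.mapHom_mk, indRep.mk_eq_mk_iff'] at hy
    obtain ⟨q, hq, h⟩ := hy
    have := hπ (op q)
    -- An element equalized at stage `q` is a morphism out of `X q` that coequalizes the kernel pair
    -- of `π q`, so it descends to `Y q`.
    let d := EffectiveEpi.desc (π.app (op q)) (X.map (homOfLE hq).op ≫ e) (by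
      intro Z g₁ g₂ hg
      obtain ⟨k, rfl, rfl⟩ := (hpb q).exists_lift g₁ g₂ hg
      rw [Category.assoc, Category.assoc, ← l.naturality_assoc, ← r.naturality_assoc, h])
    refine ⟨F.obj.map d (w.elt q), ?_⟩
    rw [hα, EffectiveEpi.fac, indRep.mk_map]
  refine ⟨⟨indRep X, hG⟩, ObjectProperty.homMk α, ⟨hG, ⟨fun {a b} f _ => ?_⟩⟩, ?_, ?_⟩
  · have hs : Function.Surjective ((indRep X).map f) := by
      intro y
      obtain ⟨p, e, rfl⟩ := indRep.exists_eq_mk y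
      obtain ⟨q, hq, d, hd⟩ := hX f e
      exact ⟨indRep.mk X q d, by rw [indRep.map_mk, hd, indRep.mk_map]⟩
    have : IsSplitEpi ((indRep X).map f) :=
      IsSplitEpi.mk' ⟨↾(Function.surjInv hs), by ext y; exact Function.surjInv_eq hs y⟩
    exact inferInstanceAs (EffectiveEpi ((indRep X).map f))
  · let Z : LexCat κ C := ⟨indRep H, indRep.isKappaLexFunctor hP H⟩
    let L : (⟨indRep X, hG⟩ : LexCat κ C) ⟶ Z := ObjectProperty.homMk (indRep.mapHom l)
    let R : (⟨indRep X, hG⟩ : LexCat κ C) ⟶ Z := ObjectProperty.homMk (indRep.mapHom r)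
    have hw : (ObjectProperty.homMk α : F ⟶ ⟨indRep X, hG⟩) ≫ L = ObjectProperty.homMk α ≫ R := by
      ext a x
      exact hαlr a x
    refine ⟨⟨⟨Z, L, R, hw, Fork.IsLimit.mk' _ fun s => ?_⟩⟩⟩
    have hs (a : C) (x : s.pt.obj.obj a) : ∃ y, α.app a y = s.ι.hom.app a x :=
      hrange a _ (congrArg (fun t : s.pt ⟶ Z => t.hom.app a x) s.condition)
    choose g hg using hs
    refine ⟨ObjectProperty.homMk
      { app a := ↾(g a)
        naturality a b f := ?_ }, ?_, fun {m} hm => ?_⟩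
    · ext x
      apply hinj
      dsimp
      rw [hg, NatTrans.naturality_apply, NatTrans.naturality_apply, hg]
    · ext a x
      exact hg a x
    · ext a x
      apply hinj
      exact (congrArg (fun t : s.pt ⟶ ⟨indRep X, hG⟩ => t.hom.app a x) hm).trans (hg a x).symm
  · intro a b i _
    change IsPullback (F.obj.map i) (α.app a) (α.app b) ((indRep X).map i)
    rw [Types.isPullback_iff]
    refine ⟨α.naturality i, fun x y h => hinj _ h.2, fun u v h => ?_⟩
    obtain ⟨p, s, hs⟩ := w.exists_eq u
    obtain ⟨q, e, he⟩ := indRep.exists_eq_mk v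
    subst hs he
    rw [hα, indRep.map_mk, indRep.mk_eq_mk_iff] at h
    obtain ⟨r, hp, hq, h⟩ := h
    have := hπ (op r)
    -- The diagonal of the square with `π r` on the left and the monomorphism `i` on the right is
    -- the element required by the pullback.
    have : StrongEpi (π.app (op r)) := inferInstance
    have sq : CommSq (X.map (homOfLE hq).op ≫ e) (π.app (op r)) i (Y.map (homOfLE hp).op ≫ s) :=
      ⟨by rw [Category.assoc, ← h, π.naturality_assoc]⟩
    refine ⟨F.obj.map sq.lift (w.elt r), ?_, ?_⟩
    · rw [← comp_apply, ← F.obj.map_comp, sq.fac_right, F.obj.map_comp, comp_apply, w.map_elt]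
    · rw [hα, sq.fac_left, indRep.mk_map]

/-! ### Names, and limits over closed sets of names -/

section Names

/-- Names for the objects of a diagram in `C`, built by well-founded recursion. A name consists of
an object `d` of `C`, possibly an element of `F.obj d`, and fewer than `κ` morphisms from `d` to the
objects of previously constructed names. -/
inductive Name (κ : Cardinal.{u}) {C : Type u} [SmallCategory C] (F : C ⥤ Type u) : C → Type u
  -- Indexing by subsets of the fixed set `κ.out`, rather than by arbitrary small types, keeps the
  -- type of names in `Type u`.
  | mk {d : C} (w : Option (F.obj d)) (k : HasCardinalLT.Set κ.out κ) (obj : k.1 → C)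
      (child : ∀ i, Name κ F (obj i)) (p : ∀ i, d ⟶ obj i) : Name κ F d

/-- Names of arbitrary objects. -/
abbrev Names (κ : Cardinal.{u}) {C : Type u} [SmallCategory C] (F : C ⥤ Type u) : Type u :=
  Σ d : C, Name κ F d

variable {κ : Cardinal.{u}} {C : Type u} [SmallCategory C] {F : C ⥤ Type u}

/-- The optional element of a name. -/
def Name.elt {d : C} : Name κ F d → Option (F.obj d)
  | .mk w _ _ _ _ => w

/-- `Child q r g` says that `g` is one of the structure morphisms of the name `q`,
with target the name `r`. -/
inductive Child : (q r : Names κ F) → (q.1 ⟶ r.1) → Prop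
  | mk {d : C} (w : Option (F.obj d)) (k : HasCardinalLT.Set κ.out κ) (obj : k.1 → C)
      (child : ∀ i, Name κ F (obj i)) (p : ∀ i, d ⟶ obj i) (i : k.1) :
      Child ⟨d, .mk w k obj child p⟩ ⟨obj i, child i⟩ (p i)

lemma hasCardinalLT_child (q : Names κ F) :
    HasCardinalLT { s : Σ r : Names κ F, q.1 ⟶ r.1 // Child q s.1 s.2 } κ := by
  obtain ⟨d, ⟨w, k, obj, child, p⟩⟩ := q
  refine k.2.of_surjective (fun i => ⟨⟨⟨obj i, child i⟩, p i⟩, .mk w k obj child p i⟩) ?_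
  rintro ⟨⟨r, g⟩, h⟩
  cases h with
  | mk _ _ _ _ _ i => exact ⟨i, rfl⟩

lemma wellFounded_child : WellFounded fun r q : Names κ F => ∃ g, Child q r g := by
  refine ⟨fun q => ?_⟩
  obtain ⟨d, n⟩ := q
  induction n with
  | mk w k obj child p ih =>
    refine ⟨_, ?_⟩
    rintro r ⟨g, h⟩
    cases h with
    | mk _ _ _ _ _ i => exact ih i

variable (κ F) in
/-- Sets of fewer than `κ` names which contain the targets of all structure morphisms. -/
@[ext]
structure Down where
  /-- the underlying set of names -/
  carrier : Set (Names κ F)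
  small : HasCardinalLT carrier κ
  closed {q r : Names κ F} {g : q.1 ⟶ r.1} (hq : q ∈ carrier) (h : Child q r g) : r ∈ carrier

namespace Down

instance : PartialOrder (Down κ F) :=
  PartialOrder.lift Down.carrier fun _ _ => Down.ext

/-- The shape of the diagram indexed by a closed set of names. -/
abbrev shape (S : Down κ F) : MulticospanShape.{u, u} where
  L := S.carrier
  R := Σ q : S.carrier, { s : Σ r : Names κ F, q.1.1 ⟶ r.1 // Child q.1 s.1 s.2 }
  fst s := s.1
  snd s := ⟨s.2.1.1, S.closed s.1.2 s.2.2⟩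

/-- The diagram indexed by a closed set of names. -/
abbrev index (S : Down κ F) : MulticospanIndex S.shape C where
  left q := q.1.1
  right s := s.2.1.1.1
  fst s := s.2.1.2
  snd _ := 𝟙 _

end Down

lemma hasCardinalLT_arrow_walkingMulticospan [Fact κ.IsRegular] {J : MulticospanShape.{u, u}}
    (hL : HasCardinalLT J.L κ) (hR : HasCardinalLT J.R κ) :
    HasCardinalLT (Arrow (WalkingMulticospan J)) κ := by
  have hκ : Cardinal.aleph0 ≤ κ := Cardinal.IsRegular.aleph0_le Fact.out
  have : HasCardinalLT ((J.L ⊕ J.R) ⊕ (J.R ⊕ J.R)) κ := by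
    simp only [hasCardinalLT_sum_iff _ _ _ hκ]
    tauto
  refine this.of_surjective (Sum.elim
    (Sum.elim (fun i => Arrow.mk (𝟙 (WalkingMulticospan.left i)))
      (fun j => Arrow.mk (𝟙 (WalkingMulticospan.right j))))
    (Sum.elim (fun j => Arrow.mk (WalkingMulticospan.Hom.fst j))
      (fun j => Arrow.mk (WalkingMulticospan.Hom.snd j)))) ?_
  rintro ⟨a, b, f⟩
  change WalkingMulticospan.Hom a b at f
  cases f with
  | id =>
    cases a with
    | left i => exact ⟨.inl (.inl i), rfl⟩
    | right j => exact ⟨.inl (.inr j), rfl⟩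
  | fst j => exact ⟨.inr (.inl j), rfl⟩
  | snd j => exact ⟨.inr (.inr j), rfl⟩

namespace Down

variable [Fact κ.IsRegular]

lemma hasCardinalLT_arrow (S : Down κ F) : HasCardinalLT (Arrow (WalkingMulticospan S.shape)) κ :=
  hasCardinalLT_arrow_walkingMulticospan S.small
    (hasCardinalLT_sigma _ _ S.small fun _ => hasCardinalLT_child _)

variable [hC : Fact (IsKappaLexCategory κ C)]

instance (S : Down κ F) : HasLimitsOfShape (WalkingMulticospan S.shape) C :=
  hC.out _ S.hasCardinalLT_arrow

/-- The limit of the diagram indexed by a closed set of names. -/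
noncomputable def obj (S : Down κ F) : C := multiequalizer S.index

/-- The projections of the limit indexed by a closed set of names. -/
noncomputable def proj (S : Down κ F) (q : Names κ F) (hq : q ∈ S.carrier) : S.obj ⟶ q.1 :=
  Multiequalizer.ι S.index ⟨q, hq⟩

lemma proj_child (S : Down κ F) {q r : Names κ F} {g : q.1 ⟶ r.1} (h : Child q r g)
    (hq : q ∈ S.carrier) : S.proj q hq ≫ g = S.proj r (S.closed hq h) :=
  (Multiequalizer.condition S.index ⟨⟨q, hq⟩, ⟨⟨r, g⟩, h⟩⟩).trans (Category.comp_id _)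

/-- The universal property of the limit indexed by a closed set of names. -/
noncomputable def lift (S : Down κ F) {t : C} (f : ∀ q ∈ S.carrier, t ⟶ q.1)
    (hf : ∀ (q r : Names κ F) (g : q.1 ⟶ r.1) (h : Child q r g) (hq : q ∈ S.carrier),
      f q hq ≫ g = f r (S.closed hq h)) : t ⟶ S.obj :=
  Multiequalizer.lift S.index t (fun q => f q.1 q.2)
    (fun s => (hf _ _ _ s.2.2 s.1.2).trans (Category.comp_id _).symm)

@[simp]
lemma lift_proj (S : Down κ F) {t : C} (f : ∀ q ∈ S.carrier, t ⟶ q.1)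
    (hf : ∀ (q r : Names κ F) (g : q.1 ⟶ r.1) (h : Child q r g) (hq : q ∈ S.carrier),
      f q hq ≫ g = f r (S.closed hq h)) (q : Names κ F) (hq : q ∈ S.carrier) :
    S.lift f hf ≫ S.proj q hq = f q hq :=
  Multiequalizer.lift_ι S.index _ _ _ _

lemma hom_ext {S : Down κ F} {t : C} {f g : t ⟶ S.obj}
    (h : ∀ q hq, f ≫ S.proj q hq = g ≫ S.proj q hq) : f = g :=
  Multiequalizer.hom_ext S.index _ _ fun q => h q.1 q.2

/-- As `F` preserves the limit, compatible families of elements over `S` glue; `elt_ext` gives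
uniqueness. -/
lemma exists_elt (hF : IsKappaLexFunctor κ F) (S : Down κ F) (f : ∀ q ∈ S.carrier, F.obj q.1)
    (hf : ∀ (q r : Names κ F) (g : q.1 ⟶ r.1) (h : Child q r g) (hq : q ∈ S.carrier),
      F.map g (f q hq) = f r (S.closed hq h)) :
    ∃ x : F.obj S.obj, ∀ q hq, F.map (S.proj q hq) x = f q hq := by
  have := hF _ S.hasCardinalLT_arrow
  have hl := isLimitOfPreserves F (limit.isLimit S.index.multicospan)
  let s : (S.index.multicospan ⋙ F).sections :=
    { val := fun i => match i with
        | .left q => f q.1 q.2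
        | .right s => F.map s.2.1.2 (f s.1.1 s.1.2)
      property := by
        rintro i _ (_ | s | s)
        · exact ConcreteCategory.congr_hom ((S.index.multicospan ⋙ F).map_id i) _
        · rfl
        · exact (ConcreteCategory.congr_hom (F.map_id _) _).trans
            (hf _ _ _ s.2.2 s.1.2).symm }
  obtain ⟨x, hx, -⟩ := (Types.isLimit_iff _).1 ⟨hl⟩ s.1 s.2
  exact ⟨x, fun q hq => hx (.left ⟨q, hq⟩)⟩

lemma elt_ext (hF : IsKappaLexFunctor κ F) {S : Down κ F} {x y : F.obj S.obj}
    (h : ∀ q hq, F.map (S.proj q hq) x = F.map (S.proj q hq) y) : x = y := by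
  have := hF _ S.hasCardinalLT_arrow
  have hl := isLimitOfPreserves F (limit.isLimit S.index.multicospan)
  refine (Types.isLimitEquivSections hl).injective (Subtype.ext (funext fun i => ?_))
  change F.map (limit.π S.index.multicospan i) x = F.map (limit.π S.index.multicospan i) y
  cases i with
  | left q => exact h q.1 q.2
  | right s =>
    have e : limit.π S.index.multicospan (.right s) = S.proj s.1.1 s.1.2 ≫ s.2.1.2 :=
      (limit.w S.index.multicospan (WalkingMulticospan.Hom.fst s)).symm
    have e' (z : F.obj S.obj) : F.map (limit.π S.index.multicospan (.right s)) z =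
        F.map s.2.1.2 (F.map (S.proj s.1.1 s.1.2) z) :=
      (congrArg (fun t => F.map t z) e).trans (ConcreteCategory.congr_hom (F.map_comp _ _) z)
    exact (e' x).trans ((congrArg _ (h s.1.1 s.1.2)).trans (e' y).symm)

/-- The map between limits given by an inclusion of closed sets of names. -/
noncomputable def restrict {S T : Down κ F} (h : S ≤ T) : T.obj ⟶ S.obj :=
  S.lift (fun q hq => T.proj q (h hq)) (fun _ _ _ hc hq => T.proj_child hc (h hq))

@[simp]
lemma restrict_proj {S T : Down κ F} (h : S ≤ T) (q : Names κ F) (hq : q ∈ S.carrier) :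
    restrict h ≫ S.proj q hq = T.proj q (h hq) :=
  lift_proj _ _ _ _ _

variable (κ F) in
/-- The limits indexed by closed sets of names, as a functor. -/
noncomputable def functor : (Down κ F)ᵒᵖ ⥤ C where
  obj S := S.unop.obj
  map f := restrict (leOfHom f.unop)
  map_id S := hom_ext fun q hq => by simp
  map_comp f g := hom_ext fun q hq => by simp

/-- A directed union of closed sets of names gives a cofiltered limit of limits. -/
noncomputable def isColimitMapCocone {J : Type*} [Preorder J] [IsDirectedOrder J]
    (K : J ⥤ Down κ F) (c : Cocone K) (hc : ∀ q ∈ c.pt.carrier, ∃ j, q ∈ (K.obj j).carrier) :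
    IsColimit ((functor κ F).rightOp.mapCocone c) := by
  choose j hj using hc
  let σ (s : Cocone (K ⋙ (functor κ F).rightOp)) (i : J) : unop s.pt ⟶ (K.obj i).obj :=
    (s.ι.app i).unop
  -- By directedness the component at a name does not depend on the stage used to compute it, so the
  -- chosen stages `j` are harmless.
  have key (s : Cocone (K ⋙ (functor κ F).rightOp)) (q : Names κ F) (i i' : J)
      (hi : q ∈ (K.obj i).carrier) (hi' : q ∈ (K.obj i').carrier) :
      σ s i ≫ (K.obj i).proj q hi = σ s i' ≫ (K.obj i').proj q hi' := by
    obtain ⟨m, hm, hm'⟩ := exists_ge_ge i i'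
    have e {i : J} (hm : i ≤ m) : σ s i = σ s m ≫ restrict (leOfHom (K.map (homOfLE hm))) :=
      congrArg Quiver.Hom.unop (s.w (homOfLE hm)).symm
    rw [e hm, e hm', Category.assoc, Category.assoc, restrict_proj, restrict_proj]
  let l (s : Cocone (K ⋙ (functor κ F).rightOp)) : unop s.pt ⟶ c.pt.obj :=
    c.pt.lift (fun q hq => σ s (j q hq) ≫ (K.obj (j q hq)).proj q (hj q hq))
      (fun q r g h hq => by
        rw [Category.assoc, proj_child _ h]
        exact key s r _ _ _ _)
  exact
    { desc s := (l s).op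
      fac s i := by
        refine Quiver.Hom.unop_inj ?_
        change l s ≫ restrict (leOfHom (c.ι.app i)) = σ s i
        refine hom_ext fun q hq => ?_
        rw [Category.assoc, restrict_proj, lift_proj]
        exact key s q _ _ _ _
      uniq s m hm := by
        refine Quiver.Hom.unop_inj ?_
        let μ : unop s.pt ⟶ c.pt.obj := m.unop
        change μ = l s
        refine hom_ext fun q hq => ?_
        have e : μ ≫ restrict (leOfHom (c.ι.app (j q hq))) = σ s (j q hq) :=
          congrArg Quiver.Hom.unop (hm (j q hq))
        rw [lift_proj, ← e, Category.assoc, restrict_proj] }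

end Down

end Names

lemma effectiveEpi_of_isPullback {C : Type u₁} [Category.{v₁} C] [Regular C] {a b c d : C}
    {t : a ⟶ b} {l : a ⟶ c} {r : b ⟶ d} {m : c ⟶ d} (h : IsPullback t l r m) [EffectiveEpi r] :
    EffectiveEpi l := by
  have : IsRegularEpi l := Regular.regularEpiIsStableUnderBaseChange.of_isPullback h
    (inferInstanceAs (IsRegularEpi r))
  infer_instance

/-! ### Adjoining names, and transfinite cocomposition of covers -/

section Covers

variable {κ : Cardinal.{u}} [Fact κ.IsRegular] {C : Type u} [SmallCategory C] {F : C ⥤ Type u}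
  [hC : Fact (IsKappaLexCategory κ C)]

/-- The structure morphisms of the name `q` are the components of a morphism to the limit indexed
by a closed set of names. -/
def HasBoundary (q : Names κ F) (T : Down κ F) (f : q.1 ⟶ T.obj) : Prop :=
  ∀ (r : Names κ F) (g : q.1 ⟶ r.1), Child q r g ↔ ∃ hr : r ∈ T.carrier, f ≫ T.proj r hr = g

/-- This is how objects over the diagram enter it: any morphism to the limit of a closed set can be
the boundary of a name, because that set embeds in `κ.out`. -/
lemma exists_name {d : C} (w : Option (F.obj d)) (T : Down κ F) (f : d ⟶ T.obj) :
    ∃ n : Name κ F d, n.elt = w ∧ HasBoundary ⟨d, n⟩ T f := by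
  have hT : Cardinal.mk T.carrier ≤ Cardinal.mk κ.out := by
    rw [Cardinal.mk_out]
    exact ((hasCardinalLT_iff_cardinal_mk_lt _ _).1 T.small).le
  obtain ⟨φ⟩ := Cardinal.le_def _ _ |>.1 hT
  let k : HasCardinalLT.Set κ.out κ :=
    ⟨Set.range φ, T.small.of_surjective _ Set.rangeFactorization_surjective⟩
  let e : k.1 ≃ T.carrier := (Equiv.ofInjective φ φ.injective).symm
  refine ⟨.mk w k (fun i => (e i).1.1) (fun i => (e i).1.2) (fun i => f ≫ T.proj _ (e i).2), rfl,
    fun r g => ⟨fun h => ?_, fun ⟨hr, h⟩ => ?_⟩⟩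
  · cases h with
    | mk _ _ _ _ _ i => exact ⟨(e i).2, rfl⟩
  · subst h
    obtain ⟨i, hi⟩ := e.surjective ⟨r, hr⟩
    obtain rfl : (e i).1 = r := congrArg Subtype.val hi
    exact .mk w k (fun i => (e i).1.1) (fun i => (e i).1.2) (fun i => f ≫ T.proj _ (e i).2) i

namespace Down

/-- A cone over `S` with `q` adjoined is a cone over `S` together with a morphism to `q.1` agreeing
with it on the boundary `T`. Hence adjoining a cover changes the limit by a pullback of an effective
epimorphism. -/
lemma isPullback_of_hasBoundary {T S S' : Down κ F} (hT : T ≤ S) (hS : S ≤ S') {q : Names κ F}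
    {f : q.1 ⟶ T.obj} (hf : HasBoundary q T f) (hq : q ∈ S'.carrier) (hqS : q ∉ S.carrier)
    (hS' : ∀ r ∈ S'.carrier, r ∈ S.carrier ∨ r = q) :
    IsPullback (S'.proj q hq) (restrict hS) f (restrict hT) := by
  have w : S'.proj q hq ≫ f = restrict hS ≫ restrict hT := hom_ext fun r hr => by
    rw [Category.assoc, Category.assoc, restrict_proj, restrict_proj,
      S'.proj_child ((hf r _).2 ⟨hr, rfl⟩)]
  refine ⟨⟨w⟩, ⟨PullbackCone.isLimitAux' _ fun s => ?_⟩⟩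
  have h (r : Names κ F) (hr : r ∈ S'.carrier) : ∃ φ : s.pt ⟶ r.1,
      (∀ h : r ∈ S.carrier, φ = s.snd ≫ S.proj r h) ∧
      (∀ e : q = r, φ = s.fst ≫ eqToHom (congrArg Sigma.fst e)) := by
    by_cases h : r ∈ S.carrier
    · exact ⟨s.snd ≫ S.proj r h, fun _ => rfl, fun e => (hqS (e ▸ h)).elim⟩
    · obtain rfl := (hS' r hr).resolve_left h
      exact ⟨s.fst, fun h' => (h h').elim, fun e => by simp⟩
  choose φ hφ hφ' using h
  have hφq : φ q hq = s.fst := by simpa using hφ' q hq rfl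
  refine ⟨S'.lift φ fun r r' g h hr => ?_, ?_, ?_, fun {m} h₁ h₂ => hom_ext fun r hr => ?_⟩
  · by_cases hrS : r ∈ S.carrier
    · rw [hφ r hr hrS, hφ r' _ (S.closed hrS h), Category.assoc, proj_child _ h]
    · obtain rfl := (hS' r hr).resolve_left hrS
      obtain ⟨hr', rfl⟩ := (hf r' g).1 h
      rw [hφq, hφ r' _ (hT hr'), ← Category.assoc, s.condition, Category.assoc, restrict_proj]
  · exact (lift_proj _ _ _ _ _).trans hφq
  · refine hom_ext fun r hr => ?_
    exact (Category.assoc _ _ _).trans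
      ((congrArg _ (restrict_proj _ _ _)).trans ((lift_proj _ _ _ _ _).trans (hφ r _ hr)))
  · let μ : s.pt ⟶ S'.obj := m
    have h₁' : μ ≫ S'.proj q hq = s.fst := h₁
    have h₂' : μ ≫ restrict hS = s.snd := h₂
    change μ ≫ _ = _
    rw [lift_proj]
    by_cases hrS : r ∈ S.carrier
    · rw [hφ r hr hrS, ← h₂', Category.assoc, restrict_proj]
    · obtain rfl := (hS' r hr).resolve_left hrS
      rw [hφq, h₁']

end Down

/-- A name is a cover if its structure morphisms are the components of an effective epimorphism
onto the limit indexed by a closed set of names. -/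
def IsCover (q : Names κ F) : Prop :=
  ∃ (T : Down κ F) (f : q.1 ⟶ T.obj), HasBoundary q T f ∧ EffectiveEpi f

namespace Down

/-- The missing names are adjoined one at a time along a well-order. Each successor step is a
pullback of an effective epimorphism, limit stages are unions and so give limits, and cocomposition
closure concludes. -/
lemma effectiveEpi_restrict (hreg : IsKappaRegularCategory κ C) {S S' : Down κ F} (h : S ≤ S')
    (hcov : ∀ q ∈ S'.carrier, q ∉ S.carrier → IsCover q) : EffectiveEpi (restrict h) := by
  have := hreg.regular
  let D : Type u := { q : Names κ F // q ∈ S'.carrier ∧ q ∉ S.carrier }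
  let ρ : D → D → Prop := fun r q => ∃ g, Child q.1 r.1 g
  have : IsWellFounded D ρ := ⟨InvImage.wf Subtype.val wellFounded_child⟩
  -- Extending the child relation to a well-order ensures that the boundary of a name is present
  -- before the name itself is adjoined.
  let : LinearOrder D := IsWellFounded.wellOrderExtension ρ
  have hρ {r q : D} (h : ρ r q) : r < q := Prod.Lex.left _ _ (IsWellFounded.rank_lt_of_rel h)
  have : WellFoundedLT D := IsWellFounded.wellOrderExtension.isWellFounded_lt ρ
  -- Stage `j` contains the added names strictly below `j`. The top element makes the last stage all
  -- of `S'`, and makes `J` non-empty when nothing is added.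
  let J := WithTop D
  let : OrderBot J := WellFoundedLT.toOrderBot J
  let : SuccOrder J := SuccOrder.ofLinearWellFoundedLT J
  have hJ : HasCardinalLT J κ := by
    refine (hasCardinalLT_option_iff D _ (Cardinal.IsRegular.aleph0_le Fact.out)).2 ?_
    exact S'.small.of_injective (fun q => ⟨q.1, q.2.1⟩)
      fun q r e => Subtype.ext (congrArg (fun t : S'.carrier => t.1) e)
  let K₀ (j : J) : Down κ F :=
    { carrier := { q | q ∈ S.carrier ∨ ∃ h : q ∈ S'.carrier ∧ q ∉ S.carrier, ((⟨q, h⟩ : D) : J) < j }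
      small := S'.small.of_injective (fun q => ⟨q.1, q.2.elim (fun t => h t) fun t => t.1.1⟩)
        fun q r e => Subtype.ext (congrArg (fun t : S'.carrier => t.1) e)
      closed := by
        rintro q r g (hq | ⟨hq, hlt⟩) hc
        · exact .inl (S.closed hq hc)
        · by_cases hr : r ∈ S.carrier
          · exact .inl hr
          · refine .inr ⟨⟨S'.closed hq.1 hc, hr⟩, lt_trans (WithTop.coe_lt_coe.2 (hρ ⟨g, hc⟩)) hlt⟩ }
  have hmono : Monotone K₀ := by
    rintro i j hij q (hq | ⟨hq, hlt⟩)
    · exact .inl hq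
    · exact .inr ⟨hq, hlt.trans_le hij⟩
  have hSK (j : J) : S ≤ K₀ j := fun q hq => .inl hq
  have hKS (j : J) : K₀ j ≤ S' := by
    rintro q (hq | ⟨hq, -⟩)
    exacts [h hq, hq.1]
  have hbot : K₀ ⊥ = S := by
    refine le_antisymm ?_ (hSK _)
    rintro q (hq | ⟨hq, hlt⟩)
    exacts [hq, (not_lt_bot hlt).elim]
  let K : J ⥤ Down κ F := hmono.functor
  let c : Cocone K := ⟨S', { app := fun j => homOfLE (hKS j) }⟩
  have hc : ∀ q ∈ c.pt.carrier, ∃ j, q ∈ (K.obj j).carrier := by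
    intro q hq
    refine ⟨⊤, ?_⟩
    by_cases hqS : q ∈ S.carrier
    · exact .inl hqS
    · exact .inr ⟨⟨hq, hqS⟩, WithTop.coe_lt_top _⟩
  have hcont : (K ⋙ (functor κ F).rightOp).IsWellOrderContinuous := by
    refine ⟨fun m hm => ?_⟩
    have : Nonempty (Set.Iio m) := ⟨⟨⊥, hm.bot_lt⟩⟩
    refine ⟨isColimitMapCocone _ ((Set.principalSegIio m).cocone K) ?_⟩
    rintro q (hq | ⟨hq, hlt⟩)
    · exact ⟨Classical.arbitrary _, .inl hq⟩
    · exact ⟨⟨_, hm.succ_lt hlt⟩, .inr ⟨hq, Order.lt_succ_of_not_isMax hlt.not_isMax⟩⟩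
  have hstep (j : J) (hj : ¬ IsMax j) :
      (effectiveEpis C).op ((K ⋙ (functor κ F).rightOp).map (homOfLE (Order.le_succ j))) := by
    change EffectiveEpi (restrict (hmono (Order.le_succ j)))
    obtain ⟨⟨q, hq⟩, rfl⟩ : ∃ q : D, (q : J) = j :=
      WithTop.ne_top_iff_exists.1 fun e => hj (e ▸ isMax_top)
    obtain ⟨T, f, hf, _⟩ := hcov q hq.1 hq.2
    have hT : T ≤ K₀ ((⟨q, hq⟩ : D) : J) := by
      intro r hr
      have hch := (hf r _).2 ⟨hr, rfl⟩
      by_cases hrS : r ∈ S.carrier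
      · exact .inl hrS
      · exact .inr ⟨⟨S'.closed hq.1 hch, hrS⟩, WithTop.coe_lt_coe.2 (hρ ⟨_, hch⟩)⟩
    have hqj : q ∈ (K₀ (Order.succ ((⟨q, hq⟩ : D) : J))).carrier :=
      .inr ⟨hq, Order.lt_succ_of_not_isMax hj⟩
    refine effectiveEpi_of_isPullback
      (isPullback_of_hasBoundary hT (hmono (Order.le_succ _)) hf hqj ?_ ?_)
    · rintro (hqS | ⟨_, hlt⟩)
      exacts [hq.2 hqS, lt_irrefl _ hlt]
    · rintro r (hr | ⟨hr, hlt⟩)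
      · exact .inl (.inl hr)
      · rcases ((Order.lt_succ_iff_of_not_isMax hj).1 hlt).lt_or_eq with hlt | he
        · exact .inl (.inr ⟨hr, hlt⟩)
        · exact .inr (congrArg Subtype.val (WithTop.coe_injective he))
  have hst := hreg.cocomposition J hJ
  -- The bottom stage equals `S` only propositionally, hence a general `T` for which the equality
  -- can be substituted.
  have fac (T : Down κ F) (e : T = S) (hT : T ≤ S') :
      (eqToIso (congrArg (fun T : Down κ F => op T.obj) e)).inv ≫ (restrict hT).op =
        (restrict h).op := by
    subst e
    exact Category.id_comp _
  have key : (effectiveEpis C).op (restrict h).op := by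
    refine hst.le _ ⟨{
      F := K ⋙ (functor κ F).rightOp
      isoBot := eqToIso (congrArg (fun T : Down κ F => op T.obj) hbot)
      incl := ((functor κ F).rightOp.mapCocone c).ι
      isColimit := isColimitMapCocone K c hc
      fac := fac _ hbot (hKS _)
      map_mem := hstep }⟩
  exact key

end Down

end Covers

lemma IsKappaLexFunctor.preservesLimitsOfShape_of_finCategory {κ : Cardinal.{u}} [Fact κ.IsRegular]
    {C : Type u₁} [Category.{v₁} C] {D : Type u₂} [Category.{v₂} D] {F : C ⥤ D}
    (hF : IsKappaLexFunctor κ F) (J : Type) [SmallCategory J] [FinCategory J] :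
    PreservesLimitsOfShape J F := by
  have := hF (ULiftHom.{u} (ULift.{u} J)) (hasCardinalLT_of_finite _ _
    (Cardinal.IsRegular.aleph0_le Fact.out))
  exact preservesLimitsOfShape_of_equiv (ULiftHomULiftCategory.equiv J).symm F

/-! ### The diagram of valid names and its basic part -/

section Valid

variable {κ : Cardinal.{u}} [Fact κ.IsRegular] {C : Type u} [SmallCategory C] {F : C ⥤ Type u}
  [hC : Fact (IsKappaLexCategory κ C)]

/-- A name with an element is basic if its structure morphisms respect the elements. -/
def IsBasic (q : Names κ F) : Prop :=
  ∃ x, q.2.elt = some x ∧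
    ∀ (r : Names κ F) (g : q.1 ⟶ r.1), Child q r g → r.2.elt = some (F.map g x)

/-- A name is valid if it is basic, or if it has no element and is a cover. -/
def IsValid (q : Names κ F) : Prop :=
  IsBasic q ∨ q.2.elt = none ∧ IsCover q

lemma IsValid.isBasic {q : Names κ F} (h : IsValid q) (hq : q.2.elt.isSome) : IsBasic q := by
  rcases h with h | ⟨h, -⟩
  · exact h
  · simp [h] at hq

lemma IsValid.isCover {q : Names κ F} (h : IsValid q) (hq : ¬ q.2.elt.isSome) : IsCover q := by
  rcases h with ⟨x, hx, -⟩ | ⟨-, h⟩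
  · simp [hx] at hq
  · exact h

variable (κ F) in
/-- Closed sets of fewer than `κ` valid names. -/
abbrev ValidDown : Type u := { S : Down κ F // ∀ q ∈ S.carrier, IsValid q }

namespace ValidDown

/-- Regularity of `κ` keeps the union of fewer than `κ` such sets of size less than `κ`. -/
lemma isCardinalDirected : IsCardinalDirected κ (ValidDown κ F) := by
  intro ι s hι
  refine ⟨⟨⟨⋃ i, (s i).1.carrier, hasCardinalLT_iUnion _ hι fun i => (s i).1.small, ?_⟩, ?_⟩,
    fun i => ?_⟩
  · intro q r g hq h
    obtain ⟨i, hi⟩ := Set.mem_iUnion.1 hq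
    exact Set.mem_iUnion.2 ⟨i, (s i).1.closed hi h⟩
  · intro q hq
    obtain ⟨i, hi⟩ := Set.mem_iUnion.1 hq
    exact (s i).2 q hi
  · exact Set.subset_iUnion (fun i => (s i).1.carrier) i

instance : IsDirectedOrder (ValidDown κ F) where
  directed S T := by
    obtain ⟨j, hj⟩ := isCardinalDirected (fun b : ULift.{u} Bool => cond b.down S T)
      (hasCardinalLT_of_finite _ _ (Cardinal.IsRegular.aleph0_le Fact.out))
    exact ⟨j, hj ⟨true⟩, hj ⟨false⟩⟩

/-- The basic names in a closed set of valid names. -/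
def base (S : ValidDown κ F) : Down κ F where
  carrier := { q | q ∈ S.1.carrier ∧ q.2.elt.isSome }
  small := S.1.small.of_injective (fun q => ⟨q.1, q.2.1⟩)
    fun q r e => Subtype.ext (congrArg (fun t : S.1.carrier => t.1) e)
  closed hq h := by
    obtain ⟨x, -, hx⟩ := (S.2 _ hq.1).isBasic hq.2
    exact ⟨S.1.closed hq.1 h, by simp [hx _ _ h]⟩

lemma base_le (S : ValidDown κ F) : S.base ≤ S.1 := fun _ h => h.1

lemma base_mono : Monotone (base : ValidDown κ F → Down κ F) := fun _ _ h _ hq => ⟨h hq.1, hq.2⟩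

/-- Adjoining a valid name whose structure morphisms have targets in a given set. -/
def insert (S : ValidDown κ F) (q : Names κ F) (hq : IsValid q)
    (h : ∀ r g, Child q r g → r ∈ S.1.carrier) : ValidDown κ F :=
  ⟨{ carrier := S.1.carrier ∪ {q}
     small := hasCardinalLT_union (Cardinal.IsRegular.aleph0_le Fact.out) S.1.small
       (hasCardinalLT_of_finite _ _ (Cardinal.IsRegular.aleph0_le Fact.out))
     closed := by
       rintro _ r g (hq | rfl) hc
       exacts [.inl (S.1.closed hq hc), .inl (h r g hc)] }, by
    rintro _ (h | rfl)
    exacts [S.2 _ h, hq]⟩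

variable (κ F) in
/-- The limits indexed by closed sets of valid names. -/
noncomputable def diagram : (ValidDown κ F)ᵒᵖ ⥤ C :=
  (Subtype.mono_coe _).functor.op ⋙ Down.functor κ F

variable (κ F) in
/-- The limits indexed by sets of basic names. -/
noncomputable def baseDiagram : (ValidDown κ F)ᵒᵖ ⥤ C :=
  base_mono.functor.op ⋙ Down.functor κ F

variable (κ F) in
/-- The comparison of limits given by forgetting the names that are not basic. -/
noncomputable def toBase : diagram κ F ⟶ baseDiagram κ F where
  app S := Down.restrict S.unop.base_le
  naturality S T f := by
    have h : T.unop ≤ S.unop := leOfHom f.unop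
    change Down.restrict (show T.unop.1 ≤ S.unop.1 from h) ≫ Down.restrict T.unop.base_le =
      Down.restrict S.unop.base_le ≫ Down.restrict (base_mono h)
    exact Down.hom_ext fun q hq => by simp

lemma effectiveEpi_toBase (hreg : IsKappaRegularCategory κ C) (S : (ValidDown κ F)ᵒᵖ) :
    EffectiveEpi ((toBase κ F).app S) :=
  Down.effectiveEpi_restrict hreg S.unop.base_le fun q hq hq' =>
    (S.unop.2 q hq).isCover fun h => hq' ⟨hq, h⟩

/-- The pullback of `f` along `e` is an effective epimorphism onto the limit over `S`, hence the
boundary of a cover name. Once this name is adjoined, its projection followed by the other leg of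
the pullback is the lift. -/
lemma exists_lift [Regular C] (S : ValidDown κ F) {a b : C} (f : a ⟶ b) [EffectiveEpi f]
    (e : S.1.obj ⟶ b) :
    ∃ (T : ValidDown κ F) (hT : S ≤ T) (d : T.1.obj ⟶ a),
      d ≫ f = Down.restrict (show S.1 ≤ T.1 from hT) ≫ e := by
  obtain ⟨n, hn, hb⟩ := exists_name (F := F) none S.1 (pullback.snd f e)
  let q : Names κ F := ⟨_, n⟩
  have hq : IsValid q := .inr ⟨hn, S.1, _, hb, effectiveEpi_of_isPullback (.of_hasPullback f e)⟩
  let T := S.insert q hq fun r g h => ((hb r g).1 h).1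
  have hT : S ≤ T := Set.subset_union_left
  have hqT : q ∈ T.1.carrier := .inr rfl
  refine ⟨T, hT, T.1.proj q hqT ≫ pullback.fst f e, ?_⟩
  have h : T.1.proj q hqT ≫ pullback.snd f e = Down.restrict (show S.1 ≤ T.1 from hT) :=
    Down.hom_ext fun r hr => by
      rw [Category.assoc, Down.restrict_proj, T.1.proj_child ((hb r _).2 ⟨hr, rfl⟩)]
  rw [Category.assoc, pullback.condition, ← Category.assoc, h]

lemma exists_elt_base (hF : IsKappaLexFunctor κ F) (S : ValidDown κ F) :
    ∃ x : F.obj S.base.obj, ∀ q hq, q.2.elt = some (F.map (S.base.proj q hq) x) := by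
  have h (q : Names κ F) (hq : q ∈ S.base.carrier) := (S.2 q hq.1).isBasic hq.2
  choose f hf hf' using h
  obtain ⟨x, hx⟩ := S.base.exists_elt hF f fun q r g hc hq =>
    Option.some_injective _ ((hf' q hq r g hc).symm.trans (hf r _))
  exact ⟨x, fun q hq => by rw [hx, hf q hq]⟩

/-- The functor `F` is the filtered colimit of the functors represented by the limits indexed by
sets of basic names. -/
lemma nonempty_indPresentation [Regular C] (hF : IsKappaLexFunctor κ F) :
    Nonempty (IndPresentation F (baseDiagram κ F)) := by
  choose elt helt using exists_elt_base (F := F) hF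
  have map_elt {S T : ValidDown κ F} (h : S ≤ T) :
      F.map (Down.restrict (base_mono h)) (elt T) = elt S :=
    Down.elt_ext hF fun q hq => Option.some_injective _ (by
      rw [← helt, ← comp_apply, ← F.map_comp, Down.restrict_proj, ← helt])
  refine ⟨elt, map_elt, fun {a} x => ?_, fun {a S e e'} h => ?_⟩
  -- A name for `a` with element `x` and empty boundary is vacuously basic, and its projection
  -- represents `x`.
  · let T : Down κ F := ⟨∅, hasCardinalLT_of_finite _ _ (Cardinal.IsRegular.aleph0_le Fact.out),
      fun h => h.elim⟩
    obtain ⟨n, hn, hb⟩ := exists_name (some x) T (T.lift (fun _ h => h.elim) fun _ _ _ _ h => h.elim)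
    let q : Names κ F := ⟨a, n⟩
    have hc (r : Names κ F) (g : q.1 ⟶ r.1) : ¬ Child q r g := fun h => ((hb r g).1 h).1
    let S : ValidDown κ F := insert ⟨T, fun _ h => h.elim⟩ q
      (.inl ⟨x, hn, fun r g h => (hc r g h).elim⟩) fun r g h => (hc r g h).elim
    have hq : q ∈ S.base.carrier := ⟨.inr rfl, by simp [q, hn]⟩
    refine ⟨S, S.base.proj q hq, Option.some_injective _ ?_⟩
    exact (helt S q hq).symm.trans hn
  · change S.base.obj ⟶ a at e e'
    have := hF.preservesLimitsOfShape_of_finCategory WalkingParallelPair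
    -- `F` preserves the equalizer of `e` and `e'`, so the universal element lifts to it. The
    -- equalizer with this lift is a basic name over `S.base`, and adjoining it identifies `e` with
    -- `e'`.
    have hl := isLimitForkMapOfIsLimit F (equalizer.condition e e') (equalizerIsEqualizer e e')
    obtain ⟨x, hx, -⟩ := (Types.type_equalizer_iff_unique _ _).1 ⟨hl⟩ (elt S) h
    obtain ⟨n, hn, hb⟩ := exists_name (some x) S.base (equalizer.ι e e')
    let q : Names κ F := ⟨_, n⟩
    have hq : IsValid q := .inl ⟨x, hn, fun r g hc => by
      obtain ⟨hr, rfl⟩ := (hb r g).1 hc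
      rw [helt S r hr, F.map_comp, comp_apply, hx]⟩
    let T := S.insert q hq fun r g h => ((hb r g).1 h).1.1
    have hT : S ≤ T := Set.subset_union_left
    have hqT : q ∈ T.base.carrier := ⟨.inr rfl, by simp [q, hn]⟩
    refine ⟨T, hT, ?_⟩
    have h : T.base.proj q hqT ≫ equalizer.ι e e' = Down.restrict (base_mono hT) :=
      Down.hom_ext fun r hr => by
        rw [Category.assoc, Down.restrict_proj, T.base.proj_child ((hb r _).2 ⟨hr, rfl⟩)]
    change Down.restrict (base_mono hT) ≫ e = Down.restrict (base_mono hT) ≫ e'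
    rw [← h, Category.assoc, Category.assoc, equalizer.condition]

end ValidDown

end Valid

end KappaRegular

theorem mainTheorem7 (κ : Cardinal.{u}) (hκ : κ.IsRegular) (C : Type u) [SmallCategory C]
    (hC : KappaRegular.IsKappaRegularCategory κ C) (F : KappaRegular.LexCat κ C) :
    ∃ (G : KappaRegular.LexCat κ C) (α : F ⟶ G),
      KappaRegular.IsKappaRegularFunctor κ G.obj ∧
        IsRegularMono α ∧ KappaRegular.IsElementary α.hom := by
  have : Fact κ.IsRegular := ⟨hκ⟩
  have : Fact (KappaRegular.IsKappaLexCategory κ C) := ⟨hC.lex⟩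
  have := hC.regular
  obtain ⟨w⟩ := KappaRegular.ValidDown.nonempty_indPresentation (κ := κ) F.property
  exact KappaRegular.exists_extension_of_indPresentation F
    KappaRegular.ValidDown.isCardinalDirected (KappaRegular.ValidDown.toBase κ F.obj)
    (KappaRegular.ValidDown.effectiveEpi_toBase hC) w
    fun S _ _ f _ e => KappaRegular.ValidDown.exists_lift S f e
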